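/- Let $\mu\ge 0$. A squared Bessel process of index $\mu$ (BESQ($\mu$), i.e. of dimension $2(\mu+1)$) started at $x\ge 0$ is a process $R=(R(t))_{t\ge 0}$ with continuous paths and $R(0)=x$ a.s., Markov with respect to its own filtration, with transition function $Q_t(x,dy)=q_t(x,y)\,dy$ on $(0,\infty)$ for $t>0$ (and $Q_0(x,\cdot)=\delta_x$), where $$q_t(x,y)=\frac1{2t}\Big(\frac yx\Big)^{\mu/2}e^{-\frac{x+y}{2t}}I_\mu\Big(\frac{\sqrt{xy}}t\Big)\quad(x>0),\qquad q_t(0,y)=\frac{y^{\mu}e^{-y/(2t)}}{(2t)^{\mu+1}\Gamma(\mu+1)},$$ and $I_\mu$ is the modified Bessel function of the first kind. Let $R$ be a BESQ($\mu$) started at $1$ on a probability space with measure $\mathbb P$, and let $(\mathcal F_t)_{t\ge0}$ be the filtration generated by $R$, augmented by the $\mathbb P$-null events and made right-continuous. Fix $a\ge 0$ and put, for $t\ge0$, $$X(t,a)=\frac{R(t+aR(t))}{R(t)} .$$ (1) Let $v\ge 0$, $t\ge 0$, not both zero, let $R^{v^2}$ be a BESQ($\mu$) started at $v^2$ (on any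 probability space), and let $X^{v^2}(t,a)=R^{v^2}(t+aR^{v^2}(t))/R^{v^2}(t)$. Then $X^{v^2}(t,a)$ has the same law as $R(a)$; that is, $\mathbb E f(X^{v^2}(t,a))=\mathbb E f(R(a))$ for every nonnegative Borel function $f$. (2) For every $t\ge 0$, $X(t,a)$ has the same law as $R(a)$, and $X(t,a)$ is independent of $\mathcal F_t$. (3) Let $\tau$ be an $(\mathcal F_t)$-stopping time with values in $[0,\infty]$, let $\mathcal F_\tau$ be its $\sigma$-algebra, and let $X(\tau,a)=R(\tau+aR(\tau))/R(\tau)$ on $\{\tau<\infty\}$. If $\tau<\infty$ a.s., then $X(\tau,a)$ has the same law as $R(a)$ and is independent of $\mathcal F_\tau$. In general, $$\mathbb P\big(A\cap\{\tau<\infty\}\cap\{X(\tau,a)\in B\}\big)=\mathbb P\big(A\cap\{\tau<\infty\}\big)\,\mathbb P\big(R(a)\in B\big)$$ for all $A\in\mathcal F_\tau$ and all Borel sets $B\subset\mathbb R$. -/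

import Mathlib

open MeasureTheory ProbabilityTheory
open scoped NNReal ENNReal

noncomputable section

/-- The modified Bessel function of the first kind `I_μ(z)` for real `z > 0`:
`I_μ(z) = ∑_{k ≥ 0} (z/2)^(2k+μ) / (k! Γ(μ+k+1))`. -/
def besselI (μ z : ℝ) : ℝ :=
  ∑' k : ℕ, (z / 2) ^ (2 * (k : ℝ) + μ) / ((k.factorial : ℝ) * Real.Gamma (μ + k + 1))

/-- The transition density `q_t(x, y)`, for `t > 0`, `x ≥ 0`, `y > 0`, of the squared Bessel
process of index `μ` (that is, of dimension `2(μ + 1)`):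
`q_t(x, y) = (1/2t) (y/x)^(μ/2) exp(-(x+y)/2t) I_μ(√(xy)/t)` for `x > 0`, and
`q_t(0, y) = (2t)^(-(μ+1)) Γ(μ+1)⁻¹ y^μ exp(-y/2t)`. -/
def besqDensity (μ t x y : ℝ) : ℝ :=
  if x = 0 then
    (2 * t) ^ (-(μ + 1)) * (Real.Gamma (μ + 1))⁻¹ * y ^ μ * Real.exp (-y / (2 * t))
  else
    1 / (2 * t) * (y / x) ^ (μ / 2) * Real.exp (-(x + y) / (2 * t)) * besselI μ (√(x * y) / t)

/-- The transition function `Q_t(x, dy)` of the squared Bessel process of index `μ`. It is carried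
by `[0, ∞)`; the values for `x < 0` are irrelevant. -/
def besqTransition (μ : ℝ) (t : ℝ≥0) (x : ℝ) : Measure ℝ :=
  if t = 0 then Measure.dirac x
  else (volume.restrict (Set.Ioi (0 : ℝ))).withDensity
    fun y => ENNReal.ofReal (besqDensity μ (t : ℝ) x y)

variable {Ω : Type*} {m : MeasurableSpace Ω}

/-- `R` is, under `P`, a squared Bessel process of index `μ` started at `x ≥ 0`: a process with
continuous paths and `R 0 = x` almost surely that is Markov, with respect to its own filtration
`σ(R u : u ≤ s)`, with the transition function of the squared Bessel process. -/
structure IsBESQ (μ x : ℝ) (R : ℝ≥0 → Ω → ℝ) (P : Measure Ω) : Prop where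
  measurable : ∀ t, Measurable (R t)
  continuous : ∀ ω, Continuous fun t => R t ω
  start : ∀ᵐ ω ∂P, R 0 ω = x
  markov : ∀ (s t : ℝ≥0) (B : Set ℝ), MeasurableSet B →
    P⟦R (s + t) ⁻¹' B | Filtration.natural R (fun u => (measurable u).stronglyMeasurable) s⟧
      =ᵐ[P] fun ω => (besqTransition μ t (R s ω)).real B

/-- The usual augmentation of a filtration: adjoin all `P`-null events to every `𝓕 t`, and pass to
the right-continuous version `⋂_{s > t}`. (The null events are those of the ambient σ-algebra `m`;
if `P` is complete on `m`, the result satisfies the usual conditions.) -/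
def usualAugmentation (P : Measure Ω) (𝓕 : Filtration ℝ≥0 m) : Filtration ℝ≥0 m :=
  Filtration.rightCont
    { seq := fun t => 𝓕 t ⊔ MeasurableSpace.generateFrom {N | MeasurableSet[m] N ∧ P N = 0}
      mono' := fun _ _ hst => sup_le_sup_right (𝓕.mono hst) _
      le' := fun t => sup_le (𝓕.le t) (MeasurableSpace.generateFrom_le fun _ hN => hN.1) }

/-- The filtration `(𝓕^R_t)` generated by a squared Bessel process and augmented so as to satisfy
the usual conditions. -/
def IsBESQ.filtration {μ x : ℝ} {R : ℝ≥0 → Ω → ℝ} {P : Measure Ω} (hR : IsBESQ μ x R P) :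
    Filtration ℝ≥0 m :=
  usualAugmentation P (Filtration.natural R fun u => (hR.measurable u).stronglyMeasurable)

/-- The Bessel time process `X(t, a) = R(t + a R(t)) / R(t)`. A squared Bessel process is almost
surely nonnegative, so `toNNReal` only matters on a null event. -/
def besselTime (R : ℝ≥0 → Ω → ℝ) (t a : ℝ≥0) (ω : Ω) : ℝ :=
  R (t + a * (R t ω).toNNReal) ω / R t ω

/-- `X(τ, a) = R(τ + a R(τ)) / R(τ)` for a random time `τ` (of interest on `{τ < ∞}` only). -/
def besselTimeAt (R : ℝ≥0 → Ω → ℝ) (τ : Ω → WithTop ℝ≥0) (a : ℝ≥0) (ω : Ω) : ℝ :=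
  besselTime R ((τ ω).untopD 0) a ω

end

open Filter Topology Set

/-! The transition density scales: a process started at y > 0 has at time d the law of y·R(d/y),
where R starts at 1. Given the past up to s, S(s + d) is thus distributed as S(s)·R(d/S(s)) with R
an independent copy. The lag d = a·S(s) turns the quotient S(s + d)/S(s) into R(a), whose law no
longer involves the past.

Both the time τ and the lag are random. In `IsBESQ.lintegral_discretized` they are rounded up to a
grid: on each of the countably many events where the rounded time and lag are constant, the simple
Markov property `IsBESQ.lintegral_markov` applies. Then `IsBESQ.lintegral_besselTimeAt` refines the
grid, using path continuity and dominated convergence. Rounding strictly upward also disposes of the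
right limit in the filtration.

The quotient requires R(τ) > 0 for arbitrary τ, so R must never hit 0 (`IsBESQ.ae_forall_pos`). Let
G be `besqResolventZero μ`. Then G(0) = ∞ because μ ≥ 0, while G(1) < ∞, and e^{-t}G(R_t) is a
supermartingale. The maximal inequality on grids bounds the probability of falling below δ before
time T by e^T G(1)/G(δ), which tends to 0 with δ. -/

/-! ### Scaling of the transition function -/

/-- Brownian-type scaling of the squared Bessel transition density. -/
lemma besqDensity_mul_left (μ : ℝ) {t x z : ℝ} (ht : 0 < t) (hx : 0 < x) :
    x * besqDensity μ t x (x * z) = besqDensity μ (t / x) 1 z := by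
  have h1 : √(x * (x * z)) = x * √z := by
    rw [← mul_assoc, Real.sqrt_mul (by positivity), Real.sqrt_mul_self hx.le]
  have h2 : x * √z / t = √(1 * z) / (t / x) := by
    rw [one_mul]; field_simp
  have h3 : x * z / x = z / 1 := by field_simp
  have h4 : -(x + x * z) / (2 * t) = -(1 + z) / (2 * (t / x)) := by field_simp
  rw [besqDensity, besqDensity, if_neg hx.ne', if_neg one_ne_zero, h1, h2, h3, h4]
  field_simp

/-- Scaling of the squared Bessel transition function. -/
lemma besqTransition_apply_scaling (μ : ℝ) (t : ℝ≥0) {x : ℝ} (hx : 0 < x) {B : Set ℝ}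
    (hB : MeasurableSet B) :
    besqTransition μ t x B = besqTransition μ (t / x.toNNReal) 1 ((x * ·) ⁻¹' B) := by
  have hB' : MeasurableSet ((x * ·) ⁻¹' B) := hB.preimage (measurable_const_mul x)
  rcases eq_or_ne t 0 with rfl | ht
  · have h1 : (1 : ℝ) ∈ (x * ·) ⁻¹' B ↔ x ∈ B := by rw [mem_preimage, mul_one]
    rw [besqTransition, besqTransition, zero_div, if_pos rfl, if_pos rfl, Measure.dirac_apply' _ hB,
      Measure.dirac_apply' _ hB']
    by_cases h : x ∈ B
    · rw [indicator_of_mem h, indicator_of_mem (h1.2 h)]; rfl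
    · rw [indicator_of_notMem h, indicator_of_notMem (mt h1.1 h)]
  have hx' : x.toNNReal ≠ 0 := by simpa using hx
  have ht0 : (0 : ℝ) < t := by exact_mod_cast pos_iff_ne_zero.2 ht
  have hpos : MeasurableSet (Ioi (0 : ℝ)) := measurableSet_Ioi
  rw [besqTransition, besqTransition, if_neg ht, if_neg (div_ne_zero ht hx'),
    withDensity_apply _ hB, withDensity_apply _ hB', Measure.restrict_restrict hB,
    Measure.restrict_restrict hB', ← lintegral_indicator (hB.inter hpos),
    ← lintegral_indicator (hB'.inter hpos)]
  -- Substitution y = x z; the Jacobian x is absorbed by the scaling identity for the density.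
  have hv : (volume : Measure ℝ) =
      ENNReal.ofReal |x| • Measure.map (x * ·) volume := (Real.smul_map_volume_mul_left hx.ne').symm
  conv_lhs => rw [hv]
  rw [lintegral_smul_measure, show (x * ·) = ⇑(Homeomorph.mulLeft₀ x hx.ne') from rfl,
    (Homeomorph.mulLeft₀ x hx.ne').measurableEmbedding.lintegral_map, smul_eq_mul,
    ← lintegral_const_mul' _ _ ENNReal.ofReal_ne_top]
  refine lintegral_congr fun z => ?_
  simp only [Homeomorph.coe_mulLeft₀]
  by_cases hz : z ∈ (x * ·) ⁻¹' B ∩ Ioi 0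
  · have hz' : x * z ∈ B ∩ Ioi 0 := ⟨hz.1, mul_pos hx hz.2⟩
    rw [indicator_of_mem hz, indicator_of_mem hz', ← ENNReal.ofReal_mul (abs_nonneg x),
      abs_of_pos hx, besqDensity_mul_left μ ht0 hx, NNReal.coe_div, Real.coe_toNNReal _ hx.le]
  · have hz' : x * z ∉ B ∩ Ioi 0 := fun h => hz ⟨h.1, (mul_pos_iff_of_pos_left hx).1 h.2⟩
    rw [indicator_of_notMem hz, indicator_of_notMem hz', mul_zero]

/-! ### One-dimensional laws and the simple Markov property -/

section SquaredBessel

variable {Ω Ω' : Type*} {m : MeasurableSpace Ω} {m' : MeasurableSpace Ω'}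
  {P : Measure Ω} {P' : Measure Ω'}
  {μ x : ℝ} {R : ℝ≥0 → Ω → ℝ} {S : ℝ≥0 → Ω' → ℝ}

/-- The natural filtration of a squared Bessel process. -/
abbrev IsBESQ.natural (hS : IsBESQ μ x S P') : Filtration ℝ≥0 m' :=
  Filtration.natural S fun u => (hS.measurable u).stronglyMeasurable

lemma IsBESQ.measurable_natural (hS : IsBESQ μ x S P') (s : ℝ≥0) :
    Measurable[hS.natural s] (S s) :=
  ((Filtration.stronglyAdapted_natural
    fun u => (hS.measurable u).stronglyMeasurable) s).measurable

lemma IsBESQ.measurable_uncurry (hS : IsBESQ μ x S P') :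
    Measurable fun p : ℝ≥0 × Ω' => S p.1 p.2 :=
  measurable_uncurry_of_continuous_of_measurable hS.continuous hS.measurable

/-- The one-dimensional laws of a squared Bessel process. -/
lemma IsBESQ.law [IsProbabilityMeasure P'] (hS : IsBESQ μ x S P') (t : ℝ≥0) {B : Set ℝ} (hB : MeasurableSet B) :
    P'.real (S t ⁻¹' B) = (besqTransition μ t x).real B := by
  have h := hS.markov 0 t B hB
  have hE : MeasurableSet (S (0 + t) ⁻¹' B) := hB.preimage (hS.measurable _)
  have h1 := integral_condExp (μ := P') (hS.natural.le 0)
    (f := (S (0 + t) ⁻¹' B).indicator fun _ => (1 : ℝ))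
  rw [integral_indicator_const _ hE, integral_congr_ae h] at h1
  have h2 : (fun ω => (besqTransition μ t (S 0 ω)).real B) =ᵐ[P']
      fun _ => (besqTransition μ t x).real B := by
    filter_upwards [hS.start] with ω hω
    rw [hω]
  rw [integral_congr_ae h2] at h1
  simpa using h1.symm

/-- For t > 0 the transition function is carried by (0, ∞), whatever the starting point; only at
time 0 does x > 0 matter. -/
lemma IsBESQ.ae_pos [IsProbabilityMeasure P'] (hS : IsBESQ μ x S P') {t : ℝ≥0} (h : 0 < x ∨ 0 < t) :
    ∀ᵐ ω ∂P', 0 < S t ω := by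
  rcases eq_or_ne t 0 with rfl | ht
  · filter_upwards [hS.start] with ω hω
    rw [hω]
    exact h.resolve_right (lt_irrefl _)
  have h1 := hS.law t (B := (Ioi 0)ᶜ) measurableSet_Ioi.compl
  rw [besqTransition, if_neg ht, measureReal_def (μ := Measure.withDensity _ _),
    withDensity_apply _ measurableSet_Ioi.compl,
    Measure.restrict_restrict measurableSet_Ioi.compl] at h1
  simp only [compl_inter_self, Measure.restrict_empty, lintegral_zero_measure,
    ENNReal.toReal_zero] at h1
  rw [measureReal_eq_zero_iff] at h1
  exact measure_eq_zero_iff_ae_notMem.1 h1 |>.mono fun ω hω => by simpa using hω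

/-- The transition function at `x > 0` in terms of a process started at `1`. -/
lemma IsBESQ.transition_eq [IsProbabilityMeasure P] (hR : IsBESQ μ 1 R P) (t : ℝ≥0) {y : ℝ} (hy : 0 < y) {B : Set ℝ}
    (hB : MeasurableSet B) :
    (besqTransition μ t y).real B = P.real {ω | y * R (t / y.toNNReal) ω ∈ B} := by
  rw [measureReal_def, besqTransition_apply_scaling μ t hy hB, ← measureReal_def,
    ← hR.law _ (hB.preimage (measurable_const_mul y))]
  rfl

/-- The `P`-augmentation adds nothing up to null events. -/
lemma exists_measurableSet_ae_eq_of_sup_null {F : MeasurableSpace Ω} {C : Set Ω}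
    (hC : MeasurableSet[F ⊔ MeasurableSpace.generateFrom {N | MeasurableSet[m] N ∧ P N = 0}] C) :
    ∃ C', MeasurableSet[F] C' ∧ C =ᵐ[P] C' := by
  have hle : F ⊔ MeasurableSpace.generateFrom {N | MeasurableSet[m] N ∧ P N = 0} ≤
      eventuallyMeasurableSpace F (ae P) := by
    refine sup_le (fun s hs => ⟨s, hs, EventuallyEq.rfl⟩) (MeasurableSpace.generateFrom_le ?_)
    exact fun N hN => ⟨∅, @MeasurableSet.empty _ F, ae_eq_empty.2 hN.2⟩
  exact hle C hC

lemma IsBESQ.measurable_pair (hS : IsBESQ μ x S P') (hR : IsBESQ μ 1 R P) (s d : ℝ≥0) :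
    Measurable fun p : Ω' × Ω => S s p.1 * R (d / (S s p.1).toNNReal) p.2 := by
  have h1 : Measurable fun p : Ω' × Ω => S s p.1 := (hS.measurable s).comp measurable_fst
  exact h1.mul (hR.measurable_uncurry.comp
    (((measurable_const.div h1.real_toNNReal)).prodMk measurable_snd))

/-- The Markov property, with the transition function expressed by a process `R` started at `1`. -/
lemma IsBESQ.lintegral_markov [IsProbabilityMeasure P'] [IsProbabilityMeasure P]
    (hS : IsBESQ μ x S P') (hR : IsBESQ μ 1 R P) (s d : ℝ≥0)
    (hpos : ∀ᵐ ω ∂P', 0 < S s ω) {C : Set Ω'}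
    (hC : MeasurableSet[hS.natural s ⊔
      MeasurableSpace.generateFrom {N | MeasurableSet[m'] N ∧ P' N = 0}] C)
    {ψ : ℝ × ℝ → ℝ≥0∞} (hψ : Measurable ψ) :
    ∫⁻ ω' in C, ψ (S s ω', S (s + d) ω') ∂P' =
      ∫⁻ ω' in C, ∫⁻ ω, ψ (S s ω', S s ω' * R (d / (S s ω').toNNReal) ω) ∂P ∂P' := by
  obtain ⟨C', hC', hCC'⟩ := exists_measurableSet_ae_eq_of_sup_null hC
  rw [setLIntegral_congr hCC', setLIntegral_congr hCC']
  have hC'm : MeasurableSet C' := hS.natural.le s _ hC'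
  have hm1 : Measurable fun ω' => (S s ω', S (s + d) ω') :=
    (hS.measurable s).prodMk (hS.measurable _)
  have hm2 : Measurable fun p : Ω' × Ω => (S s p.1, S s p.1 * R (d / (S s p.1).toNNReal) p.2) :=
    ((hS.measurable s).comp measurable_fst).prodMk (hS.measurable_pair hR s d)
  -- Equality of joint laws: the product measure makes R an independent copy. Rectangles suffice,
  -- and on them this is the Markov property integrated over an event of the past.
  have key : (P'.restrict C').map (fun ω' => (S s ω', S (s + d) ω')) =
      ((P'.restrict C').prod P).map
        fun p => (S s p.1, S s p.1 * R (d / (S s p.1).toNNReal) p.2) := by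
    refine Measure.ext_prod fun {B₁ B₂} hB₁ hB₂ => ?_
    rw [Measure.map_apply hm1 (hB₁.prod hB₂), Measure.map_apply hm2 (hB₁.prod hB₂),
      Measure.prod_apply (hm2 (hB₁.prod hB₂)), Measure.restrict_apply (hm1 (hB₁.prod hB₂))]
    set D : Set Ω' := S s ⁻¹' B₁ ∩ C' with hD
    have hDm : MeasurableSet[hS.natural s] D :=
      (hS.measurable_natural s hB₁).inter hC'
    have hDm' : MeasurableSet D := hS.natural.le s _ hDm
    have hE : MeasurableSet (S (s + d) ⁻¹' B₂) := hB₂.preimage (hS.measurable _)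
    have hR2 : (∫⁻ ω', P (Prod.mk ω' ⁻¹' ((fun p : Ω' × Ω =>
        (S s p.1, S s p.1 * R (d / (S s p.1).toNNReal) p.2)) ⁻¹' B₁ ×ˢ B₂)) ∂P'.restrict C') =
        ∫⁻ ω' in D, P {ω | S s ω' * R (d / (S s ω').toNNReal) ω ∈ B₂} ∂P' := by
      rw [hD, ← Measure.restrict_restrict (hB₁.preimage (hS.measurable s)),
        ← lintegral_indicator (hB₁.preimage (hS.measurable s))]
      refine lintegral_congr fun ω' => ?_
      by_cases h : ω' ∈ S s ⁻¹' B₁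
      · rw [indicator_of_mem h]
        congr 1
        ext ω
        simp only [mem_preimage, mem_prod, mem_ofPred_eq, and_iff_right_iff_imp]
        exact fun _ => h
      · rw [indicator_of_notMem h]
        convert measure_empty (μ := P)
        ext ω
        simp only [mem_preimage, mem_prod, mem_empty_iff_false, iff_false, not_and]
        exact fun h' => absurd h' h
    have hL : (fun ω' => (S s ω', S (s + d) ω')) ⁻¹' B₁ ×ˢ B₂ ∩ C' =
        S (s + d) ⁻¹' B₂ ∩ D := by
      ext ω; simp only [hD, mem_inter_iff, mem_preimage, mem_prod]; tauto
    have hae : P'⟦S (s + d) ⁻¹' B₂ | hS.natural s⟧ =ᵐ[P']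
        fun ω' => P.real {ω | S s ω' * R (d / (S s ω').toNNReal) ω ∈ B₂} := by
      filter_upwards [hS.markov s d B₂ hB₂, hpos] with ω' h1 h2
      rw [h1, hR.transition_eq d h2 hB₂]
    have hint : Integrable (fun ω' => P.real {ω | S s ω' * R (d / (S s ω').toNNReal) ω ∈ B₂}) P' :=
      integrable_condExp.congr hae
    have h1 := setIntegral_condExp (μ := P') (hS.natural.le s)
      (f := (S (s + d) ⁻¹' B₂).indicator fun _ => (1 : ℝ)) ((integrable_const 1).indicator hE) hDm
    rw [setIntegral_congr_ae hDm' (hae.mono fun _ h _ => h), integral_indicator_const _ hE,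
      smul_eq_mul, mul_one, measureReal_restrict_apply hE] at h1
    rw [hL, hR2, ← ofReal_measureReal, ← h1, ofReal_integral_eq_lintegral_ofReal hint.integrableOn
      (Eventually.of_forall fun _ => measureReal_nonneg)]
    exact lintegral_congr fun _ => ofReal_measureReal
  have h := congrArg (fun ν => ∫⁻ p, ψ p ∂ν) key
  rw [lintegral_map hψ hm1, lintegral_map hψ hm2] at h
  exact h.trans (lintegral_prod _ (hψ.comp hm2).aemeasurable)

end SquaredBessel

/-! ### Laplace transform of the transition function from 1 -/

/-- A real `tsum` that diverges is 0 by convention, so this direction needs no summability. It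
spares a convergence proof for the Bessel series, since only an upper bound is used later. -/
lemma ofReal_tsum_le {f : ℕ → ℝ} (hf : ∀ n, 0 ≤ f n) :
    ENNReal.ofReal (∑' n, f n) ≤ ∑' n, ENNReal.ofReal (f n) := by
  by_cases h : Summable f
  · exact (ENNReal.ofReal_tsum_of_nonneg hf h).le
  · simp [tsum_eq_zero_of_not_summable h]

/-- The weights of the Poisson mixture of Gamma laws behind the squared Bessel density, tilted by
`exp (-(b - c) y)`. -/
lemma besqDensity_term {μ c b y : ℝ} (hμ : 0 ≤ μ) (hc : 0 < c) (hb : 0 < b) (hy : 0 < y) (k : ℕ) :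
    c * y ^ (μ / 2) * Real.exp (-(1 + y) * c) *
        ((√y * c) ^ (2 * (k : ℝ) + μ) / ((k.factorial : ℝ) * Real.Gamma (μ + k + 1))) *
        Real.exp (-((b - c) * y)) =
      (Real.exp (-c) * (c / b) ^ (μ + 1) * ((c ^ 2 / b) ^ k / k.factorial)) *
        gammaPDFReal (μ + k + 1) b y := by
  have hG : Real.Gamma (μ + k + 1) ≠ 0 := (Real.Gamma_pos_of_pos (by positivity)).ne'
  have hk : (k.factorial : ℝ) ≠ 0 := by positivity
  rw [gammaPDFReal, if_pos hy.le]
  have h1 : (√y * c) ^ (2 * (k : ℝ) + μ) = y ^ (k : ℝ) * y ^ (μ / 2) * (c ^ (2 * k) * c ^ μ) := by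
    rw [Real.mul_rpow (Real.sqrt_nonneg _) hc.le, Real.sqrt_eq_rpow, ← Real.rpow_mul hy.le,
      Real.rpow_add hc, ← Real.rpow_natCast c (2 * k), ← Real.rpow_add hy]
    congr 2
    · ring
    · push_cast; ring
  have h2 : y ^ (μ + k + 1 - 1) = y ^ (μ / 2) * y ^ (μ / 2) * y ^ (k : ℝ) := by
    rw [← Real.rpow_add hy, ← Real.rpow_add hy]
    congr 1
    ring
  have h3 : b ^ (μ + k + 1) = b ^ (μ + 1) * b ^ k := by
    rw [← Real.rpow_natCast b k, ← Real.rpow_add hb]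
    congr 1
    ring
  have h4 : (c / b) ^ (μ + 1) = c ^ μ * c / b ^ (μ + 1) := by
    rw [Real.div_rpow hc.le hb.le, Real.rpow_add hc, Real.rpow_one]
  have h5 : Real.exp (-(1 + y) * c) * Real.exp (-((b - c) * y)) =
      Real.exp (-c) * Real.exp (-(b * y)) := by
    rw [← Real.exp_add, ← Real.exp_add]
    congr 1
    ring
  have hb1 : b ^ (μ + 1) ≠ 0 := (Real.rpow_pos_of_pos hb _).ne'
  have h6 : (c ^ 2 / b) ^ k = c ^ (2 * k) / b ^ k := by rw [div_pow, pow_mul]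
  rw [h1, h2, h3, h4, h6]
  calc _ = c * y ^ (μ / 2) * (Real.exp (-(1 + y) * c) * Real.exp (-((b - c) * y))) *
        (y ^ (k : ℝ) * y ^ (μ / 2) * (c ^ (2 * k) * c ^ μ) /
          ((k.factorial : ℝ) * Real.Gamma (μ + k + 1))) := by ring
    _ = _ := by
      rw [h5]
      field_simp

/-- An upper bound (in fact an equality) for the Laplace transform of `Q_u(1, ·)`. -/
lemma lintegral_exp_besqTransition_le {μ l : ℝ} (hμ : 0 ≤ μ) (hl : 0 ≤ l) (u : ℝ≥0) :
    ∫⁻ y, ENNReal.ofReal (Real.exp (-(l * y))) ∂besqTransition μ u 1 ≤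
      ENNReal.ofReal ((1 / (1 + 2 * u * l)) ^ (μ + 1) * Real.exp (-(l / (1 + 2 * u * l)))) := by
  have hme : Measurable fun y : ℝ => ENNReal.ofReal (Real.exp (-(l * y))) := by fun_prop
  rcases eq_or_ne u 0 with rfl | hu
  · rw [besqTransition, if_pos rfl, lintegral_dirac' _ hme]
    simp
  have hu0 : (0 : ℝ) < u := by exact_mod_cast pos_iff_ne_zero.2 hu
  -- Q_u(1, ·) is a Poisson(c) mixture of Gamma laws of rate c; the factor e^{-ly} changes the rate
  -- to b = c + l and leaves the weights w below.
  set c : ℝ := 1 / (2 * u) with hc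
  have hc0 : 0 < c := by positivity
  set b : ℝ := c + l with hb
  have hb0 : 0 < b := by positivity
  have hbc : l = b - c := by rw [hb]; ring
  set a : ℕ → ℝ → ℝ := fun k y => c * y ^ (μ / 2) * Real.exp (-(1 + y) * c) *
        ((√y * c) ^ (2 * (k : ℝ) + μ) / ((k.factorial : ℝ) * Real.Gamma (μ + k + 1))) with ha
  have ham : ∀ k, Measurable fun y => ENNReal.ofReal (a k y) := fun k => by
    simp only [ha]; fun_prop
  have ha0 : ∀ k y, 0 < y → 0 ≤ a k y := fun k y hy => by
    have : 0 < Real.Gamma (μ + k + 1) := Real.Gamma_pos_of_pos (by positivity)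
    simp only [ha]; positivity
  set w : ℕ → ℝ := fun k => Real.exp (-c) * (c / b) ^ (μ + 1) * ((c ^ 2 / b) ^ k / k.factorial)
    with hw
  have hw0 : ∀ k, 0 ≤ w k := fun k => by simp only [hw]; positivity
  have hsum : HasSum w (Real.exp (-c) * (c / b) ^ (μ + 1) * Real.exp (c ^ 2 / b)) := by
    have := NormedSpace.expSeries_div_hasSum_exp (c ^ 2 / b)
    rw [← Real.exp_eq_exp_ℝ] at this
    exact this.mul_left _
  have hle : besqTransition μ u 1 ≤ (volume.restrict (Ioi (0 : ℝ))).withDensity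
      fun y => ∑' k, ENNReal.ofReal (a k y) := by
    rw [besqTransition, if_neg hu]
    refine withDensity_mono ?_
    refine (ae_restrict_iff' measurableSet_Ioi).2 (Eventually.of_forall fun y hy => ?_)
    have hy : 0 < y := hy
    refine le_trans (le_of_eq ?_) (ofReal_tsum_le fun k => ha0 k y hy)
    simp only [ha]
    rw [tsum_mul_left, besqDensity, if_neg one_ne_zero, besselI]
    have e1 : y / 1 = y := div_one y
    have e2 : -(1 + y) / (2 * (u : ℝ)) = -(1 + y) * c := by rw [hc]; field_simp
    have e3 : √(1 * y) / (u : ℝ) / 2 = √y * c := by rw [hc, one_mul]; field_simp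
    rw [e1, e2, e3]
  calc _ ≤ ∫⁻ y, ENNReal.ofReal (Real.exp (-(l * y))) ∂((volume.restrict (Ioi (0 : ℝ))).withDensity
      fun y => ∑' k, ENNReal.ofReal (a k y)) := lintegral_mono' hle le_rfl
    _ = ∫⁻ y in Ioi 0, ∑' k, ENNReal.ofReal (w k) * gammaPDF (μ + k + 1) b y := by
      rw [lintegral_withDensity_eq_lintegral_mul _ (Measurable.tsum ham) hme]
      refine setLIntegral_congr_fun measurableSet_Ioi fun y hy => ?_
      have hy : 0 < y := hy
      simp only [Pi.mul_apply]
      rw [← ENNReal.tsum_mul_right]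
      refine tsum_congr fun k => ?_
      rw [← ENNReal.ofReal_mul (ha0 k y hy), gammaPDF, ← ENNReal.ofReal_mul (hw0 k), hbc,
        ← besqDensity_term hμ hc0 hb0 hy k]
    _ ≤ ∑' k, ENNReal.ofReal (w k) := by
      have hgm : ∀ k : ℕ, Measurable (gammaPDF (μ + k + 1) b) := fun k =>
        (measurable_gammaPDFReal _ _).ennreal_ofReal
      rw [lintegral_tsum fun k => ((hgm k).const_mul _).aemeasurable]
      refine ENNReal.tsum_le_tsum fun k => ?_
      rw [lintegral_const_mul _ (hgm k)]
      have h1 := lintegral_gammaPDF_eq_one (a := μ + k + 1) (r := b) (by positivity) hb0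
      calc _ ≤ ENNReal.ofReal (w k) * 1 := by
            gcongr
            exact (setLIntegral_le_lintegral _ _).trans h1.le
        _ = _ := mul_one _
    _ = _ := by
      rw [← ENNReal.ofReal_tsum_of_nonneg hw0 hsum.summable, hsum.tsum_eq]
      congr 1
      have e1 : c / b = 1 / (1 + 2 * u * l) := by rw [hb, hc]; field_simp
      -- The leading c cancels the e^{-c} of the Poisson weights.
      have e2 : c ^ 2 / b = c - l * (c / b) := by rw [hbc]; field_simp; ring
      rw [mul_comm (Real.exp (-c)), mul_assoc, ← Real.exp_add, e2, e1]
      congr 2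
      ring

/-! ### The resolvent density at 0 and its supermartingale property -/

/-- The resolvent density at `0` of the squared Bessel process: a multiple of
`∫ e^{-t} p_t(x, 0) dt`, where `p` is the transition density with respect to the speed measure. -/
noncomputable def besqResolventZero (μ x : ℝ) : ℝ≥0∞ :=
  ∫⁻ t in Ioi (0 : ℝ),
    ENNReal.ofReal (Real.exp (-t) * t ^ (-(μ + 1)) * Real.exp (-(x / (2 * t))))

lemma besqResolventZero_antitone (μ : ℝ) : Antitone (besqResolventZero μ) := by
  intro x y hxy
  refine setLIntegral_mono' measurableSet_Ioi fun t (ht : 0 < t) => ?_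
  gcongr

lemma measurable_besqResolventZero (μ : ℝ) : Measurable (besqResolventZero μ) :=
  (besqResolventZero_antitone μ).measurable

/-- Near t = 0 the factor exp(-1/(2t)) beats the power t^{-(μ+1)}; at infinity e^{-t} gives
integrability. -/
lemma besqResolventZero_one_lt_top {μ : ℝ} (hμ : 0 ≤ μ) : besqResolventZero μ 1 < ∞ := by
  set p := μ + 1 with hp
  have hp0 : 0 < p := by positivity
  have hbound : ∀ t : ℝ, 0 < t → Real.exp (-t) * t ^ (-p) * Real.exp (-(1 / (2 * t))) ≤
      (2 * p) ^ p * Real.exp (-t) := by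
    intro t ht
    -- From z ≤ e^z at z = 1/(2tp), chosen so that the p-th power produces exactly exp(1/(2t)).
    have h1 : t⁻¹ ≤ 2 * p * Real.exp (1 / (2 * t) / p) := by
      have := Real.add_one_le_exp (1 / (2 * t) / p)
      calc t⁻¹ = 2 * p * (1 / (2 * t) / p) := by field_simp
        _ ≤ _ := by gcongr; linarith
    have h2 : t ^ (-p) ≤ (2 * p) ^ p * Real.exp (1 / (2 * t)) := by
      rw [Real.rpow_neg ht.le, ← Real.inv_rpow ht.le]
      refine (Real.rpow_le_rpow (by positivity) h1 hp0.le).trans (le_of_eq ?_)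
      rw [Real.mul_rpow (by positivity) (Real.exp_pos _).le, ← Real.exp_mul]
      congr 2
      field_simp
    calc _ ≤ Real.exp (-t) * ((2 * p) ^ p * Real.exp (1 / (2 * t))) * Real.exp (-(1 / (2 * t))) := by
          gcongr
      _ = (2 * p) ^ p * Real.exp (-t) * (Real.exp (1 / (2 * t)) * Real.exp (-(1 / (2 * t)))) := by
          ring
      _ = _ := by rw [← Real.exp_add, add_neg_cancel, Real.exp_zero, mul_one]
  have hint : IntegrableOn (fun t : ℝ => (2 * p) ^ p * Real.exp (-t)) (Ioi 0) :=
    (integrableOn_exp_neg_Ioi 0).const_mul _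
  refine lt_of_le_of_lt ?_ hint.lintegral_lt_top
  exact setLIntegral_mono' measurableSet_Ioi fun t ht => ENNReal.ofReal_le_ofReal (hbound t ht)

/-- On (0, 1] the integrand dominates a multiple of 1/t. This is where μ ≥ 0, rather than μ > -1, is
really needed. -/
lemma besqResolventZero_zero {μ : ℝ} (hμ : 0 ≤ μ) : besqResolventZero μ 0 = ∞ := by
  have h1 : ¬ IntegrableOn (fun t : ℝ => t⁻¹) (Ioc 0 1) := by
    rw [← intervalIntegrable_iff_integrableOn_Ioc_of_le zero_le_one, intervalIntegrable_inv_iff]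
    simp
  have h2 : ∫⁻ t in Ioc (0 : ℝ) 1, ENNReal.ofReal t⁻¹ = ∞ := by
    by_contra h
    refine h1 ⟨measurable_inv.aestronglyMeasurable, ?_⟩
    rw [hasFiniteIntegral_iff_ofReal]
    · exact lt_top_iff_ne_top.2 h
    · exact (ae_restrict_iff' measurableSet_Ioc).2
        (Eventually.of_forall fun t ht => inv_nonneg.2 ht.1.le)
  refine top_unique ?_
  calc ∞ = ENNReal.ofReal (Real.exp (-1)) * ∫⁻ t in Ioc (0 : ℝ) 1, ENNReal.ofReal t⁻¹ := by
        rw [h2, ENNReal.mul_top (by simp [Real.exp_pos])]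
    _ = ∫⁻ t in Ioc (0 : ℝ) 1, ENNReal.ofReal (Real.exp (-1) * t⁻¹) := by
        rw [← lintegral_const_mul' _ _ ENNReal.ofReal_ne_top]
        exact lintegral_congr fun t => (ENNReal.ofReal_mul (Real.exp_pos _).le).symm
    _ ≤ ∫⁻ t in Ioc (0 : ℝ) 1,
        ENNReal.ofReal (Real.exp (-t) * t ^ (-(μ + 1)) * Real.exp (-(0 / (2 * t)))) := by
        refine setLIntegral_mono' measurableSet_Ioc fun t ht => ENNReal.ofReal_le_ofReal ?_
        have h3 : t⁻¹ ≤ t ^ (-(μ + 1)) := by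
          rw [← Real.rpow_neg_one]
          exact Real.rpow_le_rpow_of_exponent_ge ht.1 ht.2 (by linarith)
        rw [zero_div, neg_zero, Real.exp_zero, mul_one]
        have := ht.1
        have := ht.2
        gcongr
    _ ≤ _ := lintegral_mono_set Ioc_subset_Ioi_self

/-- Monotone convergence: the integrand increases as the space variable decreases to 0. -/
lemma tendsto_besqResolventZero {μ : ℝ} (hμ : 0 ≤ μ) :
    Tendsto (fun n : ℕ => besqResolventZero μ (1 / ((n : ℝ) + 1))) atTop (𝓝 ∞) := by
  rw [← besqResolventZero_zero hμ]
  refine lintegral_tendsto_of_tendsto_of_monotone (fun n => ?_) ?_ ?_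
  · exact (by fun_prop : Measurable _).aemeasurable
  · refine (ae_restrict_iff' measurableSet_Ioi).2 (Eventually.of_forall fun t (ht : 0 < t) => ?_)
    intro n k hnk
    simp only
    gcongr
  · refine Eventually.of_forall fun t => ENNReal.tendsto_ofReal ?_
    have : Tendsto (fun n : ℕ => Real.exp (-(1 / ((n : ℝ) + 1) / (2 * t)))) atTop
        (𝓝 (Real.exp (-(0 / (2 * t))))) :=
      (Real.continuous_exp.tendsto _).comp
        ((tendsto_one_div_add_atTop_nhds_zero_nat (𝕜 := ℝ)).div_const (2 * t)).neg
    exact this.const_mul _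

/-- The semigroup shifts the resolvent integral by d; the discarded piece over (0, d) is the
supermartingale's loss. -/
lemma setLIntegral_Ioi_add_le (f : ℝ → ℝ≥0∞) {d : ℝ} (hd : 0 ≤ d) :
    ∫⁻ t in Ioi (0 : ℝ), f (t + d) ≤ ∫⁻ t in Ioi (0 : ℝ), f t := by
  rw [← lintegral_indicator measurableSet_Ioi, ← lintegral_indicator measurableSet_Ioi]
  refine le_trans (lintegral_mono fun t => ?_)
    (lintegral_add_right_eq_self ((Ioi (0 : ℝ)).indicator f) d).le
  by_cases ht : t ∈ Ioi (0 : ℝ)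
  · have h : t + d ∈ Ioi (0 : ℝ) := add_pos_of_pos_of_nonneg ht hd
    rw [indicator_of_mem ht, indicator_of_mem h]
  · rw [indicator_of_notMem ht]; exact bot_le

section SquaredBessel

variable {Ω Ω' : Type*} {m : MeasurableSpace Ω} {m' : MeasurableSpace Ω'}
  {P : Measure Ω} {P' : Measure Ω'}
  {μ x : ℝ} {R : ℝ≥0 → Ω → ℝ} {S : ℝ≥0 → Ω' → ℝ}

/-- `IsBESQ.law` only concerns `Measure.real`, which sends ∞ to 0. Real total mass 1 excludes this,
so the existence of the process shows that the transition function is a probability measure. -/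
lemma IsBESQ.map_eq [IsProbabilityMeasure P'] (hS : IsBESQ μ x S P') (t : ℝ≥0) :
    P'.map (S t) = besqTransition μ t x := by
  have h1 : (besqTransition μ t x).real univ = 1 := by
    rw [← hS.law t MeasurableSet.univ]; simp
  have h2 : besqTransition μ t x univ ≠ ∞ := fun h => by
    rw [measureReal_def, h] at h1; simp at h1
  have : IsFiniteMeasure (besqTransition μ t x) := ⟨lt_top_iff_ne_top.2 h2⟩
  refine Measure.ext fun B hB => ?_
  rw [Measure.map_apply (hS.measurable t) hB, ← ofReal_measureReal, hS.law t hB, ofReal_measureReal]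

/-- `e^{-t} G(R_t)` is a supermartingale for the resolvent density `G` at `0`. -/
lemma IsBESQ.lintegral_resolventZero_le [IsProbabilityMeasure P] (hμ : 0 ≤ μ) (hR : IsBESQ μ 1 R P)
    (d : ℝ≥0) {y : ℝ} (hy : 0 < y) :
    ∫⁻ ω, ENNReal.ofReal (Real.exp (-d)) * besqResolventZero μ (y * R (d / y.toNNReal) ω) ∂P ≤
      besqResolventZero μ y := by
  set u := d / y.toNNReal with hu
  have hud : (u : ℝ) * y = d := by
    rw [hu, NNReal.coe_div, Real.coe_toNNReal _ hy.le]; field_simp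
  have hRu := hR.measurable u
  have hm : Measurable (Function.uncurry fun (ω : Ω) (t : ℝ) => ENNReal.ofReal (Real.exp (-d)) *
      ENNReal.ofReal (Real.exp (-t) * t ^ (-(μ + 1)) *
        Real.exp (-(y * R u ω / (2 * t))))) := by
    have : Measurable fun p : Ω × ℝ => R u p.1 := hRu.comp measurable_fst
    unfold Function.uncurry
    fun_prop
  calc _ = ∫⁻ ω, (∫⁻ t in Ioi (0 : ℝ), ENNReal.ofReal (Real.exp (-d)) *
        ENNReal.ofReal (Real.exp (-t) * t ^ (-(μ + 1)) * Real.exp (-(y * R u ω / (2 * t))))) ∂P := by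
        refine lintegral_congr fun ω => ?_
        rw [besqResolventZero, lintegral_const_mul' _ _ ENNReal.ofReal_ne_top]
    _ = ∫⁻ t in Ioi (0 : ℝ), ∫⁻ ω, ENNReal.ofReal (Real.exp (-d)) *
        ENNReal.ofReal (Real.exp (-t) * t ^ (-(μ + 1)) * Real.exp (-(y * R u ω / (2 * t)))) ∂P :=
        lintegral_lintegral_swap hm.aemeasurable
    _ ≤ ∫⁻ t in Ioi (0 : ℝ), ENNReal.ofReal (Real.exp (-(t + d)) * (t + d) ^ (-(μ + 1)) *
          Real.exp (-(y / (2 * (t + d))))) := by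
        refine setLIntegral_mono' measurableSet_Ioi fun t (ht : 0 < t) => ?_
        have h0 : ∀ ω, ENNReal.ofReal (Real.exp (-d)) *
            ENNReal.ofReal (Real.exp (-t) * t ^ (-(μ + 1)) * Real.exp (-(y * R u ω / (2 * t)))) =
            ENNReal.ofReal (Real.exp (-(t + d)) * t ^ (-(μ + 1))) *
              ENNReal.ofReal (Real.exp (-(y / (2 * t) * R u ω))) := by
          intro ω
          rw [← ENNReal.ofReal_mul (Real.exp_pos _).le, ← ENNReal.ofReal_mul (by positivity)]
          congr 1
          rw [neg_add t, Real.exp_add, div_mul_eq_mul_div]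
          ring
        simp only [h0]
        rw [lintegral_const_mul' _ _ ENNReal.ofReal_ne_top]
        -- As u y = d, the bound is (t/(t+d))^{μ+1} exp(-y/(2(t+d))): it replaces t by t + d, a
        -- Chapman–Kolmogorov relation with endpoint 0.
        have h1 := lintegral_exp_besqTransition_le hμ (l := y / (2 * t)) (by positivity) u
        rw [← hR.map_eq u, lintegral_map (by fun_prop) hRu] at h1
        refine (mul_le_mul_right h1 _).trans (le_of_eq ?_)
        rw [← ENNReal.ofReal_mul (by positivity)]
        congr 1
        have hd : (0 : ℝ) ≤ d := d.2
        have e1 : 1 + 2 * (u : ℝ) * (y / (2 * t)) = (t + d) / t := by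
          rw [← hud]; field_simp
        have e2 : y / (2 * t) / ((t + d) / t) = y / (2 * (t + d)) := by field_simp
        rw [e1, e2, one_div_div, Real.div_rpow ht.le (by positivity), Real.rpow_neg ht.le,
          Real.rpow_neg (by positivity)]
        have := (Real.rpow_pos_of_pos ht (μ + 1)).ne'
        field_simp
    _ ≤ _ := setLIntegral_Ioi_add_le (fun t => ENNReal.ofReal (Real.exp (-t) * t ^ (-(μ + 1)) *
          Real.exp (-(y / (2 * t))))) d.2

end SquaredBessel

/-! ### Maximal inequality and absence of zeros -/

/-- Maximal inequality for nonnegative supermartingales in discrete time. -/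
lemma mul_measure_exists_le_le_of_supermartingale {Ω : Type*} {m : MeasurableSpace Ω}
    {P : Measure Ω} (ℱ : Filtration ℕ m) {M : ℕ → Ω → ℝ≥0∞} (hM : ∀ k, Measurable[ℱ k] (M k))
    (hle : ∀ k C, MeasurableSet[ℱ k] C → ∫⁻ ω in C, M (k + 1) ω ∂P ≤ ∫⁻ ω in C, M k ω ∂P)
    (c : ℝ≥0∞) (n : ℕ) :
    c * P {ω | ∃ k ≤ n, c ≤ M k ω} ≤ ∫⁻ ω, M 0 ω ∂P := by
  have hM' : ∀ k, Measurable (M k) := fun k => (hM k).mono (ℱ.le k) le_rfl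
  have hup : ∀ k (B : Set Ω), MeasurableSet B →
      c * P (B ∩ {ω | c ≤ M k ω}) + ∫⁻ ω in B ∩ {ω | M k ω < c}, M k ω ∂P ≤
        ∫⁻ ω in B, M k ω ∂P := by
    intro k B hB
    have h1 : MeasurableSet {ω | c ≤ M k ω} := measurableSet_le measurable_const (hM' k)
    rw [← lintegral_inter_add_sdiff (M k) B h1]
    have h2 : B ∩ {ω | M k ω < c} = B \ {ω | c ≤ M k ω} := by
      ext ω; simp
    rw [h2]
    gcongr
    rw [← setLIntegral_const]
    exact setLIntegral_mono' (hB.inter h1) fun ω hω => hω.2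
  have hmeas : ∀ n, MeasurableSet[ℱ n] {ω | ∀ k ≤ n, M k ω < c} := by
    intro n
    have : {ω | ∀ k ≤ n, M k ω < c} = ⋂ k, ⋂ (_ : k ≤ n), {ω | M k ω < c} := by ext; simp
    rw [this]
    refine MeasurableSet.iInter fun k => MeasurableSet.iInter fun hk => ?_
    exact ℱ.mono hk _ (measurableSet_lt (hM k) measurable_const)
  -- The mass of M n on paths still below c is kept in the inequality, so that the induction closes.
  have key : ∀ n, c * P {ω | ∃ k ≤ n, c ≤ M k ω} +
      ∫⁻ ω in {ω | ∀ k ≤ n, M k ω < c}, M n ω ∂P ≤ ∫⁻ ω, M 0 ω ∂P := by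
    intro n
    induction n with
    | zero => simpa using hup 0 univ MeasurableSet.univ
    | succ n ih =>
      set B := {ω | ∀ k ≤ n, M k ω < c} with hB
      have h1 : {ω | ∃ k ≤ n + 1, c ≤ M k ω} ⊆
          {ω | ∃ k ≤ n, c ≤ M k ω} ∪ (B ∩ {ω | c ≤ M (n + 1) ω}) := by
        rintro ω ⟨k, hk, hck⟩
        by_cases h : ω ∈ B
        · rcases Nat.le_succ_iff.1 hk with h' | rfl
          · exact absurd hck (not_le.2 (h k h'))
          · exact Or.inr ⟨h, hck⟩
        · left
          simpa [hB] using h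
      have h2 : {ω | ∀ k ≤ n + 1, M k ω < c} = B ∩ {ω | M (n + 1) ω < c} := by
        ext ω
        refine ⟨fun h => ⟨fun k hk => h k (hk.trans n.le_succ), h _ le_rfl⟩, fun h k hk => ?_⟩
        rcases Nat.le_succ_iff.1 hk with h' | rfl
        · exact h.1 k h'
        · exact h.2
      rw [h2]
      calc _ ≤ c * (P {ω | ∃ k ≤ n, c ≤ M k ω} + P (B ∩ {ω | c ≤ M (n + 1) ω})) +
            ∫⁻ ω in B ∩ {ω | M (n + 1) ω < c}, M (n + 1) ω ∂P := by
            gcongr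
            exact (measure_mono h1).trans (measure_union_le _ _)
        _ = c * P {ω | ∃ k ≤ n, c ≤ M k ω} + (c * P (B ∩ {ω | c ≤ M (n + 1) ω}) +
            ∫⁻ ω in B ∩ {ω | M (n + 1) ω < c}, M (n + 1) ω ∂P) := by rw [mul_add, add_assoc]
        _ ≤ c * P {ω | ∃ k ≤ n, c ≤ M k ω} + ∫⁻ ω in B, M n ω ∂P := by
            gcongr
            exact (hup (n + 1) B (ℱ.le n _ (hmeas n))).trans (hle n B (hmeas n))
        _ ≤ _ := ih
  exact le_self_add.trans (key n)

section SquaredBessel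

variable {Ω Ω' : Type*} {m : MeasurableSpace Ω} {m' : MeasurableSpace Ω'}
  {P : Measure Ω} {P' : Measure Ω'}
  {μ x : ℝ} {R : ℝ≥0 → Ω → ℝ} {S : ℝ≥0 → Ω' → ℝ}

/-- On a grid of mesh `h`, the process is unlikely to come close to `0`. -/
lemma IsBESQ.mul_measure_exists_lt_le [IsProbabilityMeasure P] (hμ : 0 ≤ μ)
    (hR : IsBESQ μ 1 R P) (h T : ℝ≥0) (n : ℕ) (hn : n * h ≤ T) (δ : ℝ) :
    ENNReal.ofReal (Real.exp (-T)) * besqResolventZero μ δ *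
      P {ω | ∃ k : ℕ, k ≤ n ∧ R (k * h) ω < δ} ≤ besqResolventZero μ 1 := by
  set M : ℕ → Ω → ℝ≥0∞ := fun k ω =>
    ENNReal.ofReal (Real.exp (-((k * h : ℝ≥0) : ℝ))) * besqResolventZero μ (R (k * h) ω) with hM
  let ℱ : Filtration ℕ m :=
    { seq := fun k => hR.natural (k * h)
      mono' := fun i j hij => hR.natural.mono (by gcongr)
      le' := fun k => hR.natural.le _ }
  have hMm : ∀ k, Measurable[ℱ k] (M k) := fun k =>
    ((measurable_besqResolventZero μ).comp (hR.measurable_natural (k * h))).const_mul _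
  have hle : ∀ k C, MeasurableSet[ℱ k] C → ∫⁻ ω in C, M (k + 1) ω ∂P ≤ ∫⁻ ω in C, M k ω ∂P := by
    intro k C hC
    have hpos := hR.ae_pos (t := k * h) (Or.inl one_pos)
    have hstep : ((k + 1 : ℕ) : ℝ≥0) * h = k * h + h := by push_cast; ring
    have hψ : Measurable fun p : ℝ × ℝ =>
        ENNReal.ofReal (Real.exp (-((k * h + h : ℝ≥0) : ℝ))) * besqResolventZero μ p.2 :=
      ((measurable_besqResolventZero μ).comp measurable_snd).const_mul _
    have h1 := hR.lintegral_markov hR (k * h) h hpos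
      ((le_sup_left : hR.natural (k * h) ≤ _) C hC) hψ
    simp only [hM, hstep]
    rw [h1]
    refine lintegral_mono_ae (ae_restrict_of_ae (hpos.mono fun ω hω => ?_))
    have h2 := hR.lintegral_resolventZero_le hμ h hω
    rw [lintegral_const_mul' _ _ ENNReal.ofReal_ne_top] at h2
    rw [lintegral_const_mul' _ _ ENNReal.ofReal_ne_top, NNReal.coe_add, neg_add, Real.exp_add,
      ENNReal.ofReal_mul (Real.exp_pos _).le, mul_assoc]
    gcongr
  have h0 : ∫⁻ ω, M 0 ω ∂P = besqResolventZero μ 1 := by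
    have : ∀ᵐ ω ∂P, M 0 ω = besqResolventZero μ 1 := by
      filter_upwards [hR.start] with ω hω
      simp [hM, hω]
    rw [lintegral_congr_ae this]; simp
  rw [← h0]
  refine le_trans ?_ (mul_measure_exists_le_le_of_supermartingale ℱ hMm hle
    (ENNReal.ofReal (Real.exp (-T)) * besqResolventZero μ δ) n)
  refine mul_le_mul_right (measure_mono ?_) _
  rintro ω ⟨k, hk, hkδ⟩
  refine ⟨k, hk, ?_⟩
  have hkT : k * h ≤ T := le_trans (by gcongr) hn
  have := besqResolventZero_antitone μ hkδ.le
  simp only [hM]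
  gcongr

/-- By continuity, a path with a zero before T is below any δ > 0 at some point of every fine enough
grid. The grid bound does not depend on the mesh, so it passes to this event, and then δ tends to 0.
-/
lemma IsBESQ.measure_exists_eq_zero [IsProbabilityMeasure P] (hμ : 0 ≤ μ)
    (hR : IsBESQ μ 1 R P) (T : ℕ) : P {ω | ∃ t : ℝ≥0, t ≤ T ∧ R t ω = 0} = 0 := by
  set H := {ω | ∃ t : ℝ≥0, t ≤ T ∧ R t ω = 0} with hH
  set e := ENNReal.ofReal (Real.exp (-((T : ℝ≥0) : ℝ))) with he
  have he0 : e ≠ 0 := by simp [he, Real.exp_pos]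
  have hbound : ∀ j : ℕ, e * besqResolventZero μ (1 / ((j : ℝ) + 1)) * P H ≤
      besqResolventZero μ 1 := by
    intro j
    set δ : ℝ := 1 / ((j : ℝ) + 1) with hδ
    have hδ0 : 0 < δ := by positivity
    set E : ℕ → Set Ω := fun n =>
      {ω | ∃ k : ℕ, k ≤ (n + 1) * T ∧ R (k * (1 / ((n : ℝ≥0) + 1))) ω < δ} with hE
    have hEb : ∀ n, e * besqResolventZero μ δ * P (E n) ≤ besqResolventZero μ 1 := fun n =>
      hR.mul_measure_exists_lt_le hμ _ T _ (le_of_eq (by push_cast; field_simp)) δ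
    have hHE : H ⊆ ⋃ N, ⋂ n ≥ N, E n := by
      rintro ω ⟨t, htT, ht0⟩
      -- The zero is approximated by grid points from below, so that they stay within [0, T].
      have hlim : Tendsto (fun n : ℕ => (⌊t * ((n : ℝ≥0) + 1)⌋₊ : ℝ≥0) * (1 / ((n : ℝ≥0) + 1)))
          atTop (𝓝 t) := by
        have := (tendsto_nat_floor_mul_div_atTop (R := ℝ) t.2).comp
          (tendsto_natCast_atTop_atTop.comp (tendsto_add_atTop_nat 1))
        refine NNReal.tendsto_coe.1 (this.congr fun n => ?_)
        have hfl : ⌊t * ((n : ℝ≥0) + 1)⌋₊ = ⌊(t : ℝ) * ((n : ℝ) + 1)⌋₊ := 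
          (Nonneg.nat_floor_coe (t * ((n : ℝ≥0) + 1))).symm
        rw [hfl]
        simp [div_eq_mul_inv]
      have h1 : ∀ᶠ n : ℕ in atTop,
          R ((⌊t * ((n : ℝ≥0) + 1)⌋₊ : ℝ≥0) * (1 / ((n : ℝ≥0) + 1))) ω < δ := by
        refine (((hR.continuous ω).tendsto t).comp hlim).eventually (gt_mem_nhds ?_)
        rw [ht0]; exact hδ0
      obtain ⟨N, hN⟩ := eventually_atTop.1 h1
      refine mem_iUnion.2 ⟨N, mem_iInter₂.2 fun n hn => ⟨_, ?_, hN n hn⟩⟩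
      refine Nat.floor_le_of_le ?_
      push_cast
      rw [mul_comm]
      gcongr
    have hmono : Monotone fun N => ⋂ n ≥ N, E n := fun N N' h =>
      biInter_subset_biInter_left fun n hn => le_trans h hn
    calc e * besqResolventZero μ δ * P H ≤ e * besqResolventZero μ δ * P (⋃ N, ⋂ n ≥ N, E n) := by
          gcongr
      _ = ⨆ N, e * besqResolventZero μ δ * P (⋂ n ≥ N, E n) := by
          rw [hmono.measure_iUnion, ENNReal.mul_iSup]
      _ ≤ _ := iSup_le fun N => le_trans (by
          gcongr
          exact biInter_subset_of_mem (le_refl N)) (hEb N)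
  by_contra h0
  have hlim : Tendsto (fun j : ℕ => e * besqResolventZero μ (1 / ((j : ℝ) + 1)) * P H) atTop
      (𝓝 (e * ∞ * P H)) :=
    ENNReal.Tendsto.mul_const (ENNReal.Tendsto.const_mul (tendsto_besqResolventZero hμ)
      (Or.inl ENNReal.top_ne_zero)) (Or.inl (by rw [ENNReal.mul_top he0]; exact ENNReal.top_ne_zero))
  have := le_of_tendsto' hlim hbound
  rw [ENNReal.mul_top he0, ENNReal.top_mul h0] at this
  exact absurd (besqResolventZero_one_lt_top hμ) (not_lt.2 this)

/-- A squared Bessel process of index `μ ≥ 0` started at `1` never hits `0`. -/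
lemma IsBESQ.ae_forall_pos [IsProbabilityMeasure P] (hμ : 0 ≤ μ) (hR : IsBESQ μ 1 R P) :
    ∀ᵐ ω ∂P, ∀ t, 0 < R t ω := by
  have h1 : ∀ᵐ ω ∂P, ∀ T : ℕ, ω ∉ {ω | ∃ t : ℝ≥0, t ≤ T ∧ R t ω = 0} :=
    ae_all_iff.2 fun T => measure_eq_zero_iff_ae_notMem.1 (hR.measure_exists_eq_zero hμ T)
  have h2 : ∀ᵐ ω ∂P, ∀ i : ℕ, 0 < R (TopologicalSpace.denseSeq ℝ≥0 i) ω :=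
    ae_all_iff.2 fun i => hR.ae_pos (Or.inl one_pos)
  filter_upwards [h1, h2] with ω hω1 hω2 t
  refine lt_of_le_of_ne ?_ fun h => ?_
  · have hcl : IsClosed {t | 0 ≤ R t ω} := isClosed_le continuous_const (hR.continuous ω)
    exact DenseRange.induction_on (TopologicalSpace.denseRange_denseSeq ℝ≥0) t hcl
      fun i => (hω2 i).le
  · obtain ⟨T, hT⟩ := exists_nat_ge t
    exact hω1 T ⟨t, hT, h.symm⟩

end SquaredBessel

/-! ### Rounding times up to a grid -/

/-- Discretisation of time from above on the grid `(k + 1) / (n + 1)`. -/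
noncomputable def gridTime (n k : ℕ) : ℝ≥0 := ((k : ℝ≥0) + 1) / ((n : ℝ≥0) + 1)

/-- The index of the first point of the grid `gridTime n` beyond `t`. -/
noncomputable def gridIndex (n : ℕ) (t : ℝ≥0) : ℕ := ⌊t * ((n : ℝ≥0) + 1)⌋₊

lemma gridIndex_eq_iff (n k : ℕ) (t : ℝ≥0) :
    gridIndex n t = k ↔ (k : ℝ≥0) / ((n : ℝ≥0) + 1) ≤ t ∧ t < gridTime n k := by
  rw [gridIndex, gridTime, Nat.floor_eq_iff zero_le, div_le_iff₀ (by positivity),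
    lt_div_iff₀ (by positivity)]

lemma measurable_gridIndex (n : ℕ) : Measurable (gridIndex n) :=
  Nat.measurable_floor.comp (measurable_id.mul_const _)

/-- The offset k + 1 keeps the grid away from time 0, where a process started at 0 vanishes. -/
lemma gridTime_pos (n k : ℕ) : 0 < gridTime n k := by unfold gridTime; positivity

lemma measurable_gridTime (n : ℕ) : Measurable (gridTime n) := measurable_from_nat

/-- Rounding adds at most 1/(n+1). The argument varies with n because the lag is computed from the
process at the rounded time. -/
lemma tendsto_gridTime {u : ℕ → ℝ≥0} {t : ℝ≥0} (hu : Tendsto u atTop (𝓝 t)) :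
    Tendsto (fun n => gridTime n (gridIndex n (u n))) atTop (𝓝 t) := by
  have h0 : Tendsto (fun n : ℕ => u n + 1 / ((n : ℝ≥0) + 1)) atTop (𝓝 t) := by
    simpa using hu.add (tendsto_one_div_add_atTop_nhds_zero_nat (𝕜 := ℝ≥0))
  refine tendsto_of_tendsto_of_tendsto_of_le_of_le hu h0 (fun n => ?_) fun n => ?_
  · exact ((gridIndex_eq_iff n _ _).1 rfl).2.le
  · simp only [gridTime, add_div]
    gcongr
    exact ((gridIndex_eq_iff n _ _).1 rfl).1

/-! ### Strong Markov property for the Bessel time process -/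

section SquaredBessel

variable {Ω Ω' : Type*} {m : MeasurableSpace Ω} {m' : MeasurableSpace Ω'}
  {P : Measure Ω} {P' : Measure Ω'}
  {μ x : ℝ} {R : ℝ≥0 → Ω → ℝ} {S : ℝ≥0 → Ω' → ℝ}

/-- The natural filtration with the null events adjoined, before passing to right limits. -/
abbrev IsBESQ.augmented (hS : IsBESQ μ x S P') (t : ℝ≥0) : MeasurableSpace Ω' :=
  hS.natural t ⊔ MeasurableSpace.generateFrom {N | MeasurableSet[m'] N ∧ P' N = 0}

lemma IsBESQ.filtration_le_augmented (hS : IsBESQ μ x S P') {s t : ℝ≥0} (hst : s < t) :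
    hS.filtration s ≤ hS.augmented t := by
  rw [IsBESQ.filtration, usualAugmentation, Filtration.rightCont_eq]
  exact iInf₂_le t hst

/-- The strict inequality leaves room for a time s from a countable dense set with τ ≤ s < t, and
the right limit at s already lies in the augmented σ-algebra at t. -/
lemma IsBESQ.measurableSet_inter_lt (hS : IsBESQ μ x S P') {τ : Ω' → WithTop ℝ≥0}
    (hτ : IsStoppingTime hS.filtration τ) {A : Set Ω'} (hA : MeasurableSet[hτ.measurableSpace] A)
    (t : ℝ≥0) : MeasurableSet[hS.augmented t] (A ∩ {ω | τ ω < t}) := by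
  have h : A ∩ {ω | τ ω < t} = ⋃ i : ℕ, ⋃ (_ : TopologicalSpace.denseSeq ℝ≥0 i < t),
      A ∩ {ω | τ ω ≤ TopologicalSpace.denseSeq ℝ≥0 i} := by
    ext ω
    simp only [mem_inter_iff, mem_ofPred_eq, mem_iUnion, exists_prop]
    constructor
    · rintro ⟨hω, hlt⟩
      obtain ⟨s, hs⟩ := WithTop.ne_top_iff_exists.1 (ne_top_of_lt hlt)
      rw [← hs, WithTop.coe_lt_coe] at hlt
      obtain ⟨i, hi⟩ := (TopologicalSpace.denseRange_denseSeq ℝ≥0).exists_mem_open isOpen_Ioo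
        (nonempty_Ioo.2 hlt)
      exact ⟨i, hi.2, hω, by rw [← hs, WithTop.coe_le_coe]; exact hi.1.le⟩
    · rintro ⟨i, hi, hω, hle⟩
      exact ⟨hω, hle.trans_lt (WithTop.coe_lt_coe.2 hi)⟩
  rw [h]
  exact MeasurableSet.iUnion fun i => MeasurableSet.iUnion fun hi =>
    hS.filtration_le_augmented hi _ (hA.2 _)

lemma MeasureTheory.IsStoppingTime.measurable_untopD {f : Filtration ℝ≥0 m}
    {τ : Ω → WithTop ℝ≥0} (hτ : IsStoppingTime f τ) : Measurable fun ω => (τ ω).untopD 0 := by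
  have htop : MeasurableSet {ω | τ ω = ⊤} := by
    have : {ω | τ ω = ⊤} = ⋂ n : ℕ, {ω | τ ω ≤ ((n : ℝ≥0) : WithTop ℝ≥0)}ᶜ := by
      ext ω
      simp only [mem_ofPred_eq, mem_iInter, mem_compl_iff]
      refine ⟨fun h n => by simp [h], fun h => ?_⟩
      by_contra h'
      obtain ⟨s, hs⟩ := WithTop.ne_top_iff_exists.1 h'
      obtain ⟨n, hn⟩ := exists_nat_ge s
      exact h n (by rw [← hs, WithTop.coe_le_coe]; exact hn)
    rw [this]
    exact MeasurableSet.iInter fun n => (f.le _ _ (hτ _)).compl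
  refine measurable_of_Iic fun c => ?_
  -- The default value 0 puts {τ = ⊤} into every such preimage.
  have : (fun ω => (τ ω).untopD 0) ⁻¹' Iic c = {ω | τ ω ≤ c} ∪ {ω | τ ω = ⊤} := by
    ext ω
    simp only [mem_preimage, mem_Iic, mem_union, mem_ofPred_eq]
    cases τ ω with
    | top => simp
    | coe s => simp only [WithTop.untopD_coe, WithTop.coe_le_coe, WithTop.coe_ne_top, or_false]
  rw [this]
  exact (f.le _ _ (hτ c)).union htop

lemma IsBESQ.measurable_besselTimeAt (hS : IsBESQ μ x S P') {τ : Ω' → WithTop ℝ≥0}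
    (hτ : IsStoppingTime hS.filtration τ) (a : ℝ≥0) : Measurable (besselTimeAt S τ a) := by
  have h1 : Measurable fun ω => S ((τ ω).untopD 0) ω :=
    hS.measurable_uncurry.comp (hτ.measurable_untopD.prodMk measurable_id)
  exact (hS.measurable_uncurry.comp ((hτ.measurable_untopD.add
    (measurable_const.mul h1.real_toNNReal)).prodMk measurable_id)).div h1

/-- Used to pass to the limit in the time v/S(u), which is where R is evaluated after the Markov
property. -/
lemma IsBESQ.continuous_lintegral [IsProbabilityMeasure P] (hR : IsBESQ μ x R P)
    (f : BoundedContinuousFunction ℝ ℝ≥0) : Continuous fun s => ∫⁻ ω, f (R s ω) ∂P := by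
  refine continuous_iff_continuousAt.2 fun s => ?_
  refine tendsto_lintegral_filter_of_dominated_convergence (fun _ => (nndist f 0 : ℝ≥0∞))
    (Eventually.of_forall fun t => ?_) (Eventually.of_forall fun t => Eventually.of_forall fun ω => ?_)
    (by simp) (Eventually.of_forall fun ω => ?_)
  · exact (f.continuous.measurable.comp (hR.measurable t)).coe_nnreal_ennreal
  · exact ENNReal.coe_le_coe.2 (BoundedContinuousFunction.NNReal.upper_bound f _)
  · exact ENNReal.tendsto_coe.2
      ((f.continuous.tendsto _).comp ((hR.continuous ω).tendsto s))

/-- The strong Markov property, in the form needed for the Bessel time process, along the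
discretisations `gridTime n`. -/
lemma IsBESQ.lintegral_discretized [IsProbabilityMeasure P] [IsProbabilityMeasure P']
    (hS : IsBESQ μ x S P') (hR : IsBESQ μ 1 R P) (a : ℝ≥0) {τ : Ω' → WithTop ℝ≥0}
    (hτ : IsStoppingTime hS.filtration τ) {A : Set Ω'} (hA : MeasurableSet[hτ.measurableSpace] A)
    (n : ℕ) (N : Ω' → ℕ) (hN : N = fun ω => gridIndex n ((τ ω).untopD 0))
    (J : ℕ → Ω' → ℕ) (hJ : J = fun k ω => gridIndex n (a * (S (gridTime n k) ω).toNNReal))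
    (f : BoundedContinuousFunction ℝ ℝ≥0) :
    ∫⁻ ω in A ∩ {ω | τ ω ≠ ⊤}, f (S (gridTime n (N ω) + gridTime n (J (N ω) ω)) ω /
        S (gridTime n (N ω)) ω) ∂P' =
      ∫⁻ ω in A ∩ {ω | τ ω ≠ ⊤},
        ∫⁻ ω', f (R (gridTime n (J (N ω) ω) / (S (gridTime n (N ω)) ω).toNNReal) ω') ∂P ∂P' := by
  -- On each piece the rounded time and lag are constants. The lag is read off at the rounded time,
  -- not at τ, so the piece belongs to the past of that grid time.
  set C : ℕ × ℕ → Set Ω' := fun p =>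
    (A ∩ {ω | τ ω ≠ ⊤}) ∩ {ω | N ω = p.1} ∩ {ω | J p.1 ω = p.2} with hC
  have hCm : ∀ p, MeasurableSet[hS.augmented (gridTime n p.1)] (C p) := by
    rintro ⟨k, j⟩
    refine MeasurableSet.inter ?_ ?_
    · have h1 : A ∩ {ω | τ ω ≠ ⊤} ∩ {ω | N ω = k} = (A ∩ {ω | τ ω < gridTime n k}) \
          (A ∩ {ω | τ ω < ((k : ℝ≥0) / ((n : ℝ≥0) + 1) : ℝ≥0)}) := by
        ext ω
        simp only [Set.mem_sdiff, mem_inter_iff, mem_ofPred_eq, hN, gridIndex_eq_iff]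
        cases h : τ ω with
        | top => simp only [ne_eq, not_true_eq_false, and_false, false_and, not_top_lt]
        | coe s =>
          simp only [ne_eq, WithTop.coe_ne_top, not_false_eq_true, WithTop.untopD_coe,
            WithTop.coe_lt_coe, ← not_lt]
          tauto
      rw [h1]
      refine (hS.measurableSet_inter_lt hτ hA _).diff ?_
      refine sup_le_sup_right (hS.natural.mono ?_) _ _ (hS.measurableSet_inter_lt hτ hA _)
      unfold gridTime
      gcongr
      exact le_self_add
    · refine (le_sup_left : hS.natural (gridTime n k) ≤ _) _ ?_
      have : Measurable[hS.natural (gridTime n k)] (J k) := by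
        rw [hJ]
        exact (measurable_gridIndex n).comp
          (measurable_const.mul (hS.measurable_natural _).real_toNNReal)
      exact this (measurableSet_singleton j)
  have haug : ∀ t, hS.augmented t ≤ m' := fun t =>
    sup_le (hS.natural.le t) (MeasurableSpace.generateFrom_le fun _ hN => hN.1)
  have hdisj : Pairwise (Function.onFun Disjoint C) := by
    rintro ⟨k, j⟩ ⟨k', j'⟩ hne
    refine disjoint_left.2 fun ω h h' => hne ?_
    have h1 : k = k' := h.1.2.symm.trans h'.1.2
    subst h1
    rw [Prod.mk.injEq]
    exact ⟨rfl, h.2.symm.trans h'.2⟩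
  have hUnion : A ∩ {ω | τ ω ≠ ⊤} = ⋃ p, C p := by
    ext ω
    refine ⟨fun h => mem_iUnion.2 ⟨(N ω, J (N ω) ω), ⟨h, rfl⟩, rfl⟩, fun h => ?_⟩
    obtain ⟨p, hp⟩ := mem_iUnion.1 h
    exact hp.1.1
  rw [hUnion, lintegral_iUnion (fun p => haug _ _ (hCm p)) hdisj,
    lintegral_iUnion (fun p => haug _ _ (hCm p)) hdisj]
  refine tsum_congr fun p => ?_
  have hpos := hS.ae_pos (t := gridTime n p.1) (Or.inr (gridTime_pos _ _))
  have hψ : Measurable fun q : ℝ × ℝ => (f (q.2 / q.1) : ℝ≥0∞) :=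
    (f.continuous.measurable.comp (measurable_snd.div measurable_fst)).coe_nnreal_ennreal
  have h1 := hS.lintegral_markov hR (gridTime n p.1) (gridTime n p.2) hpos (hCm p) hψ
  rw [setLIntegral_congr_fun (haug _ _ (hCm p)) (g := fun ω =>
    (f (S (gridTime n p.1 + gridTime n p.2) ω / S (gridTime n p.1) ω) : ℝ≥0∞)), h1]
  · refine setLIntegral_congr_fun_ae (haug _ _ (hCm p)) (hpos.mono fun ω hω hωC => ?_)
    have e1 : N ω = p.1 := hωC.1.2
    have e2 : J p.1 ω = p.2 := hωC.2
    simp only [e1, e2]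
    refine lintegral_congr fun ω' => ?_
    rw [mul_div_cancel_left₀ _ hω.ne']
  · intro ω hωC
    have e1 : N ω = p.1 := hωC.1.2
    have e2 : J p.1 ω = p.2 := hωC.2
    simp only [e1, e2]

/-- As the grid is refined, the rounded lag divided by the position tends to a·S(τ)/S(τ) = a. The
inner integral becomes constant, and the right side factorises. -/
lemma IsBESQ.lintegral_besselTimeAt [IsProbabilityMeasure P] [IsProbabilityMeasure P']
    (hS : IsBESQ μ x S P') (hR : IsBESQ μ 1 R P) (a : ℝ≥0) {τ : Ω' → WithTop ℝ≥0}
    (hτ : IsStoppingTime hS.filtration τ)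
    (hpos : ∀ᵐ ω ∂P', 0 < S ((τ ω).untopD 0) ω) {A : Set Ω'}
    (hA : MeasurableSet[hτ.measurableSpace] A) (f : BoundedContinuousFunction ℝ ℝ≥0) :
    ∫⁻ ω in A ∩ {ω | τ ω ≠ ⊤}, f (besselTimeAt S τ a ω) ∂P' =
      P' (A ∩ {ω | τ ω ≠ ⊤}) * ∫⁻ ω, f (R a ω) ∂P := by
  set T : Ω' → ℝ≥0 := fun ω => (τ ω).untopD 0 with hT
  have hTm : Measurable T := hτ.measurable_untopD
  set u : ℕ → Ω' → ℝ≥0 := fun n ω => gridTime n (gridIndex n (T ω)) with hu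
  set v : ℕ → Ω' → ℝ≥0 := fun n ω =>
    gridTime n (gridIndex n (a * (S (u n ω) ω).toNNReal)) with hv
  have hgm : ∀ n, Measurable fun t => gridTime n (gridIndex n t) := fun n =>
    (measurable_gridTime n).comp (measurable_gridIndex n)
  have hum : ∀ n, Measurable (u n) := fun n => (hgm n).comp hTm
  have hSm : ∀ {w : Ω' → ℝ≥0}, Measurable w → Measurable fun ω => S (w ω) ω := fun hw =>
    hS.measurable_uncurry.comp (hw.prodMk measurable_id)
  have hvm : ∀ n, Measurable (v n) := fun n =>
    (hgm n).comp (measurable_const.mul (hSm (hum n)).real_toNNReal)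
  have hlimu : ∀ ω, Tendsto (fun n => u n ω) atTop (𝓝 (T ω)) := fun ω =>
    tendsto_gridTime tendsto_const_nhds
  have hlimS : ∀ ω, Tendsto (fun n => S (u n ω) ω) atTop (𝓝 (S (T ω) ω)) := fun ω =>
    ((hS.continuous ω).tendsto _).comp (hlimu ω)
  have hlimv : ∀ ω, Tendsto (fun n => v n ω) atTop (𝓝 (a * (S (T ω) ω).toNNReal)) := fun ω =>
    tendsto_gridTime (tendsto_const_nhds.mul (tendsto_real_toNNReal (hlimS ω)))
  have hbd : ∀ y, (f y : ℝ≥0∞) ≤ nndist f 0 := fun y =>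
    ENNReal.coe_le_coe.2 (BoundedContinuousFunction.NNReal.upper_bound f _)
  set A' := A ∩ {ω | τ ω ≠ ⊤} with hA'
  have hfin : ∫⁻ _ in A', (nndist f 0 : ℝ≥0∞) ∂P' ≠ ∞ := by
    rw [setLIntegral_const]
    exact ENNReal.mul_ne_top ENNReal.coe_ne_top (measure_ne_top _ _)
  have hL : Tendsto (fun n => ∫⁻ ω in A', f (S (u n ω + v n ω) ω / S (u n ω) ω) ∂P') atTop
      (𝓝 (∫⁻ ω in A', f (besselTimeAt S τ a ω) ∂P')) := by
    refine tendsto_lintegral_of_dominated_convergence (fun _ => (nndist f 0 : ℝ≥0∞))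
      (fun n => ?_) (fun n => Eventually.of_forall fun ω => hbd _) hfin
      (ae_restrict_of_ae (hpos.mono fun ω hω => ?_))
    · exact (f.continuous.measurable.comp
        ((hSm ((hum n).add (hvm n))).div (hSm (hum n)))).coe_nnreal_ennreal
    · refine ENNReal.tendsto_coe.2 ((f.continuous.tendsto _).comp ?_)
      exact (((hS.continuous ω).tendsto _).comp ((hlimu ω).add (hlimv ω))).div (hlimS ω) hω.ne'
  have hΨ := hR.continuous_lintegral f
  have hQ : Tendsto (fun n => ∫⁻ ω in A', ∫⁻ ω', f (R (v n ω / (S (u n ω) ω).toNNReal) ω') ∂P ∂P')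
      atTop (𝓝 (∫⁻ _ in A', ∫⁻ ω', f (R a ω') ∂P ∂P')) := by
    refine tendsto_lintegral_of_dominated_convergence (fun _ => (nndist f 0 : ℝ≥0∞))
      (fun n => ?_) (fun n => Eventually.of_forall fun ω => ?_) hfin
      (ae_restrict_of_ae (hpos.mono fun ω hω => ?_))
    · exact hΨ.measurable.comp ((hvm n).div (hSm (hum n)).real_toNNReal)
    · exact (lintegral_mono fun ω' => hbd _).trans (by simp)
    · refine (hΨ.tendsto a).comp ?_
      have hne : (S (T ω) ω).toNNReal ≠ 0 := by simpa using hω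
      have := (hlimv ω).div (tendsto_real_toNNReal (hlimS ω)) hne
      rwa [mul_div_cancel_right₀ _ hne] at this
  have hEq : ∀ n, ∫⁻ ω in A', f (S (u n ω + v n ω) ω / S (u n ω) ω) ∂P' =
      ∫⁻ ω in A', ∫⁻ ω', f (R (v n ω / (S (u n ω) ω).toNNReal) ω') ∂P ∂P' := fun n =>
    hS.lintegral_discretized hR a hτ hA n _ rfl _ rfl f
  simp only [hEq] at hL
  rw [tendsto_nhds_unique hL hQ, setLIntegral_const, mul_comm]

/-- At a stopping time with `R(τ) > 0`, the Bessel time process is distributed as `R(a)`,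
independently of the past. -/
theorem IsBESQ.measure_inter_besselTimeAt [IsProbabilityMeasure P] [IsProbabilityMeasure P']
    (hS : IsBESQ μ x S P') (hR : IsBESQ μ 1 R P) (a : ℝ≥0) {τ : Ω' → WithTop ℝ≥0}
    (hτ : IsStoppingTime hS.filtration τ)
    (hpos : ∀ᵐ ω ∂P', 0 < S ((τ ω).untopD 0) ω) {A : Set Ω'}
    (hA : MeasurableSet[hτ.measurableSpace] A) {B : Set ℝ} (hB : MeasurableSet B) :
    P' (A ∩ {ω | τ ω ≠ ⊤} ∩ {ω | besselTimeAt S τ a ω ∈ B}) =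
      P' (A ∩ {ω | τ ω ≠ ⊤}) * P {ω | R a ω ∈ B} := by
  have hX := hS.measurable_besselTimeAt hτ a
  set A' := A ∩ {ω | τ ω ≠ ⊤} with hA'
  have hc : P' A' ≠ ∞ := measure_ne_top _ _
  -- Integrals of bounded continuous functions determine a finite measure, which carries the result
  -- over to Borel sets.
  have key : (P'.restrict A').map (besselTimeAt S τ a) = P' A' • P.map (R a) := by
    have : IsFiniteMeasure (P' A' • P.map (R a)) := Measure.smul_finite _ hc
    refine ext_of_forall_lintegral_eq_of_IsFiniteMeasure fun f => ?_
    have hf : Measurable fun y => (f y : ℝ≥0∞) := f.continuous.measurable.coe_nnreal_ennreal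
    rw [lintegral_map hf hX, lintegral_smul_measure, lintegral_map hf (hR.measurable a),
      hS.lintegral_besselTimeAt hR a hτ hpos hA f, smul_eq_mul]
  have h := congrArg (fun ν => ν B) key
  simp only [Measure.smul_apply, smul_eq_mul] at h
  rw [Measure.map_apply hX hB, Measure.map_apply (hR.measurable a) hB,
    Measure.restrict_apply (hX hB), inter_comm] at h
  exact h

end SquaredBessel

/-! ### Law, independence and the main theorem -/

section SquaredBessel

variable {Ω Ω' : Type*} {m : MeasurableSpace Ω} {m' : MeasurableSpace Ω'}
  {P : Measure Ω} {P' : Measure Ω'}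
  {μ x : ℝ} {R : ℝ≥0 → Ω → ℝ} {S : ℝ≥0 → Ω' → ℝ}

lemma IsBESQ.measure_inter_besselTimeAt_of_ne_top [IsProbabilityMeasure P]
    [IsProbabilityMeasure P'] (hS : IsBESQ μ x S P') (hR : IsBESQ μ 1 R P) (a : ℝ≥0)
    {τ : Ω' → WithTop ℝ≥0} (hτ : IsStoppingTime hS.filtration τ) (hfin : ∀ᵐ ω ∂P', τ ω ≠ ⊤)
    (hpos : ∀ᵐ ω ∂P', 0 < S ((τ ω).untopD 0) ω) {A : Set Ω'}
    (hA : MeasurableSet[hτ.measurableSpace] A) {B : Set ℝ} (hB : MeasurableSet B) :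
    P' (A ∩ besselTimeAt S τ a ⁻¹' B) = P' A * P (R a ⁻¹' B) := by
  have e : (A ∩ {ω | τ ω ≠ ⊤} : Set Ω') =ᵐ[P'] A :=
    inter_ae_eq_left_of_ae_eq_univ (eventuallyEq_univ.2 hfin)
  have h := hS.measure_inter_besselTimeAt hR a hτ hpos hA hB
  rw [measure_congr e, measure_congr (e.inter (ae_eq_refl {ω | besselTimeAt S τ a ω ∈ B}))] at h
  exact h

/-- At an almost surely finite stopping time with `R(τ) > 0`, the Bessel time process has the law
of `R(a)`. -/
theorem IsBESQ.identDistrib_besselTimeAt [IsProbabilityMeasure P] [IsProbabilityMeasure P']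
    (hS : IsBESQ μ x S P') (hR : IsBESQ μ 1 R P) (a : ℝ≥0) {τ : Ω' → WithTop ℝ≥0}
    (hτ : IsStoppingTime hS.filtration τ) (hfin : ∀ᵐ ω ∂P', τ ω ≠ ⊤)
    (hpos : ∀ᵐ ω ∂P', 0 < S ((τ ω).untopD 0) ω) :
    IdentDistrib (besselTimeAt S τ a) (R a) P' P := by
  have hX := hS.measurable_besselTimeAt hτ a
  refine ⟨hX.aemeasurable, (hR.measurable a).aemeasurable, Measure.ext fun B hB => ?_⟩
  have h := hS.measure_inter_besselTimeAt_of_ne_top hR a hτ hfin hpos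
    (@MeasurableSet.univ _ hτ.measurableSpace) hB
  rwa [univ_inter, measure_univ, one_mul, ← Measure.map_apply hX hB,
    ← Measure.map_apply (hR.measurable a) hB] at h

/-- At an almost surely finite stopping time with `R(τ) > 0`, the Bessel time process is
independent of the past. -/
theorem IsBESQ.indep_besselTimeAt [IsProbabilityMeasure P] [IsProbabilityMeasure P']
    (hS : IsBESQ μ x S P') (hR : IsBESQ μ 1 R P) (a : ℝ≥0) {τ : Ω' → WithTop ℝ≥0}
    (hτ : IsStoppingTime hS.filtration τ) (hfin : ∀ᵐ ω ∂P', τ ω ≠ ⊤)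
    (hpos : ∀ᵐ ω ∂P', 0 < S ((τ ω).untopD 0) ω) :
    Indep (MeasurableSpace.comap (besselTimeAt S τ a) inferInstance) hτ.measurableSpace P' := by
  have hid := hS.identDistrib_besselTimeAt hR a hτ hfin hpos
  rw [Indep_iff]
  rintro _ A ⟨B, hB, rfl⟩ hA
  rw [inter_comm, mul_comm, hS.measure_inter_besselTimeAt_of_ne_top hR a hτ hfin hpos hA hB,
    ← hid.measure_mem_eq hB]

end SquaredBessel

theorem mainTheorem12
    {Ω : Type*} {m : MeasurableSpace Ω} (P : Measure Ω) [IsProbabilityMeasure P]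
    (μ : ℝ) (hμ : 0 ≤ μ) (R : ℝ≥0 → Ω → ℝ) (hR : IsBESQ μ 1 R P) (a : ℝ≥0) :
    -- the law of `X^{v²}(t, a)`, for any starting point `v²`
    (∀ {Ω' : Type*} {m' : MeasurableSpace Ω'} (P' : Measure Ω') [IsProbabilityMeasure P']
        (v : ℝ) (Rv : ℝ≥0 → Ω' → ℝ) (t : ℝ≥0),
        0 ≤ v → IsBESQ μ (v ^ 2) Rv P' → (0 < v ∨ 0 < t) →
        IdentDistrib (besselTime Rv t a) (R a) P' P ∧
        ∀ f : ℝ → ℝ≥0∞, Measurable f →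
          ∫⁻ ω, f (besselTime Rv t a ω) ∂P' = ∫⁻ ω, f (R a ω) ∂P) ∧
    -- the law of `X(t, a)`, and its independence of `𝓕_t`
    (∀ t : ℝ≥0,
        IdentDistrib (besselTime R t a) (R a) P P ∧
        Indep (MeasurableSpace.comap (besselTime R t a) inferInstance) (hR.filtration t) P) ∧
    -- the same at a stopping time
    (∀ (τ : Ω → WithTop ℝ≥0) (hτ : IsStoppingTime hR.filtration τ),
        ((∀ᵐ ω ∂P, τ ω ≠ ⊤) →
          IdentDistrib (besselTimeAt R τ a) (R a) P P ∧
          Indep (MeasurableSpace.comap (besselTimeAt R τ a) inferInstance)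
            hτ.measurableSpace P) ∧
        ∀ (A : Set Ω) (B : Set ℝ), MeasurableSet[hτ.measurableSpace] A → MeasurableSet B →
          P (A ∩ {ω | τ ω ≠ ⊤} ∩ {ω | besselTimeAt R τ a ω ∈ B}) =
            P (A ∩ {ω | τ ω ≠ ⊤}) * P {ω | R a ω ∈ B}) := by
  -- A stopping time could seek out zeros, so positivity at all times simultaneously is needed. For
  -- the start at v² the time is fixed, and `IsBESQ.ae_pos` suffices, even for v = 0.
  have hpos := hR.ae_forall_pos hμ
  refine ⟨fun P' _ v Rv t _ hRv hvt => ?_, fun t => ?_, fun τ hτ => ⟨fun hfin => ?_, ?_⟩⟩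
  · have hv : 0 < v ^ 2 ∨ 0 < t := hvt.imp_left fun h => by positivity
    have hid : IdentDistrib (besselTime Rv t a) (R a) P' P :=
      hRv.identDistrib_besselTimeAt hR a (isStoppingTime_const hRv.filtration t)
        (Eventually.of_forall fun _ => WithTop.coe_ne_top) (hRv.ae_pos hv)
    exact ⟨hid, fun f hf => (hid.comp hf).lintegral_eq⟩
  · have hfin : ∀ᵐ _ ∂P, (t : WithTop ℝ≥0) ≠ ⊤ := Eventually.of_forall fun _ => WithTop.coe_ne_top
    have hτ := isStoppingTime_const hR.filtration t
    have hind := hR.indep_besselTimeAt hR a hτ hfin (hpos.mono fun ω h => h _)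
    rw [IsStoppingTime.measurableSpace_const] at hind
    exact ⟨hR.identDistrib_besselTimeAt hR a hτ hfin (hpos.mono fun ω h => h _), hind⟩
  · exact ⟨hR.identDistrib_besselTimeAt hR a hτ hfin (hpos.mono fun ω h => h _),
      hR.indep_besselTimeAt hR a hτ hfin (hpos.mono fun ω h => h _)⟩
  · exact fun A B hA hB => hR.measure_inter_besselTimeAt hR a hτ (hpos.mono fun ω h => h _) hA hB
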